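/- Let $(L(\theta))_{\theta\in\Theta}$, $\Theta\subseteq\mathbb R^p$, be an integrable real-valued process on a probability space $(\Omega,\mathcal F,\mathbb P)$, and let $\zeta(\theta)=L(\theta)-\mathbb E L(\theta)$ be its stochastic component; assume that almost surely $\zeta$ is differentiable on $\Theta$, with gradient $\nabla\zeta$. Let $\theta^*\in\Theta$, let $V_0$ be a symmetric positive definite $p\times p$ matrix, and put $\Theta_0(r)=\{\theta\in\Theta:\|V_0(\theta-\theta^*)\|\le r\}$. Let $\nu\ge 1$, $\mathtt g>0$ and $\mathtt r_0$ be constants with $\mathtt g_0:=\mathtt g\,\nu\ge 3$, and assume condition $(ED_1)$: for each $0<r\le \mathtt r_0$ there is a constant $0<\varrho(r)\le 1/2$ such that for all $\theta\in\Theta_0(r)$ and all $|\lambda|\le\mathtt g$ $$\sup_{\gamma\in\mathbb R^p\setminus\{0\}}\log\mathbb E\exp\Bigl\{\lambda\,\frac{\gamma^{\top}\{\nabla\zeta(\theta)-\nabla\zeta(\theta^*)\}}{\varrho(r)\,\|V_0\gamma\|}\Bigr\}\le \nu^2\lambda^2/2 .$$ Fix $0<r\le \mathtt r_0$ such that $\Theta_0(r)$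 is convex, and fix $\omega\ge 3\nu\varrho(r)$. Define the upper and lower bracketing errors $$\diamondsuit^{\pm}(r)=\sup_{\theta\in\Theta_0(r)}\Bigl\{\pm\bigl[\zeta(\theta)-\zeta(\theta^*)-(\theta-\theta^*)^{\top}\nabla\zeta(\theta^*)\bigr]-\frac{\omega}{2}\|V_0(\theta-\theta^*)\|^2\Bigr\}.$$ Let $\mathbb Q=2p$ if $p\ge 2$ and $\mathbb Q=2.7$ if $p=1$, and $$z_{\mathbb Q}(x,\mathbb Q)=\begin{cases}\bigl(1+\sqrt{x+\mathbb Q}\bigr)^2,&\text{if }1+\sqrt{x+\mathbb Q}\le \mathtt g_0,\\[2pt] 1+\bigl\{2\mathtt g_0^{-1}(x+\mathbb Q)+\mathtt g_0\bigr\}^2,&\text{otherwise.}\end{cases}$$ Then for every $x\ge 0$ $$\mathbb P\bigl\{\omega^{-1}\diamondsuit^{+}(r)\ge z_{\mathbb Q}(x,\mathbb Q)\bigr\}\le e^{-x}\qquad\text{and}\qquad \mathbb P\bigl\{\omega^{-1}\diamondsuit^{-}(r)\ge z_{\mathbb Q}(x,\mathbb Q)\bigr\}\le e^{-x}.$$ 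-/

import Mathlib

open MeasureTheory ProbabilityTheory

noncomputable section

/-- The parameter space `ℝ^p` with its Euclidean norm. -/
abbrev ParamSpace (p : ℕ) : Type := EuclideanSpace ℝ (Fin p)

/-- The Euclidean norm `‖V γ‖`, for a matrix `V` and a vector `γ`. -/
def matNorm {p : ℕ} (V : Matrix (Fin p) (Fin p) ℝ) (γ : ParamSpace p) : ℝ :=
  ‖Matrix.toEuclideanCLM (𝕜 := ℝ) V γ‖

/-- The local elliptic set `Θ₀(r) = {θ ∈ Θ : ‖V (θ - θ*)‖ ≤ r}`. -/
def localSet {p : ℕ} (Θ : Set (ParamSpace p)) (V : Matrix (Fin p) (Fin p) ℝ)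
    (θs : ParamSpace p) (r : ℝ) : Set (ParamSpace p) :=
  {θ | θ ∈ Θ ∧ matNorm V (θ - θs) ≤ r}

/-- The stochastic component `ζ(θ) = L(θ) - E L(θ)` of the process `L`. -/
def stochComp {Ω : Type*} [MeasurableSpace Ω] {p : ℕ} (μ : Measure Ω)
    (L : ParamSpace p → Ω → ℝ) (θ : ParamSpace p) (w : Ω) : ℝ :=
  L θ w - ∫ w', L θ w' ∂μ

/-- The gradient at `θ` of a function on `Θ`: the vector that represents the Fréchet derivative
within `Θ`. At an interior point of `Θ` it is the usual gradient. -/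
def gradOn {p : ℕ} (Θ : Set (ParamSpace p)) (f : ParamSpace p → ℝ) (θ : ParamSpace p) :
    ParamSpace p :=
  (InnerProductSpace.toDual ℝ (ParamSpace p)).symm (fderivWithin ℝ f Θ θ)

/-- The random gradient `∇ζ(θ)` of the stochastic component. -/
def gradStoch {Ω : Type*} [MeasurableSpace Ω] {p : ℕ} (μ : Measure Ω)
    (L : ParamSpace p → Ω → ℝ) (Θ : Set (ParamSpace p)) (θ : ParamSpace p) (w : Ω) :
    ParamSpace p :=
  gradOn Θ (fun θ' => stochComp μ L θ' w) θ

/-- Condition `(ED₁)` with radius bound `r₀`, function `ρ(·)` and constants `ν`, `g`: for each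
radius `0 < r ≤ r₀`, each `θ ∈ Θ₀(r)`, each direction `γ ≠ 0` and each `|t| ≤ g`, the exponential
moment of order `t` of `γᵀ{∇ζ(θ) - ∇ζ(θ*)} / (ρ(r) ‖V γ‖)` is finite and its logarithm is at most
`ν² t² / 2`. -/
def ConditionED1 {Ω : Type*} [MeasurableSpace Ω] {p : ℕ} (μ : Measure Ω)
    (L : ParamSpace p → Ω → ℝ) (Θ : Set (ParamSpace p)) (V : Matrix (Fin p) (Fin p) ℝ)
    (θs : ParamSpace p) (ν g r₀ : ℝ) (ρ : ℝ → ℝ) : Prop :=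
  ∀ r : ℝ, 0 < r → r ≤ r₀ → 0 < ρ r ∧ ρ r ≤ 1 / 2 ∧
    ∀ θ ∈ localSet Θ V θs r, ∀ γ : ParamSpace p, γ ≠ 0 → ∀ t : ℝ, |t| ≤ g →
      Integrable (fun w => Real.exp (t *
        (inner ℝ γ (gradStoch μ L Θ θ w - gradStoch μ L Θ θs w) / (ρ r * matNorm V γ)))) μ ∧
      Real.log (∫ w, Real.exp (t *
        (inner ℝ γ (gradStoch μ L Θ θ w - gradStoch μ L Θ θs w) / (ρ r * matNorm V γ))) ∂μ)
          ≤ ν ^ 2 * t ^ 2 / 2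

/-- The remainder of the linear approximation,
`ζ(θ, θ*) - (θ - θ*)ᵀ ∇ζ(θ*)`, where `ζ(θ, θ*) = ζ(θ) - ζ(θ*)`. -/
def linRemainder {Ω : Type*} [MeasurableSpace Ω] {p : ℕ} (μ : Measure Ω)
    (L : ParamSpace p → Ω → ℝ) (Θ : Set (ParamSpace p)) (θs θ : ParamSpace p) (w : Ω) : ℝ :=
  stochComp μ L θ w - stochComp μ L θs w - inner ℝ (θ - θs) (gradStoch μ L Θ θs w)

/-- The upper bracketing error: the supremum over `Θ₀(r)`, in the extended reals, of
`ζ(θ, θ*) - (θ - θ*)ᵀ ∇ζ(θ*) - (ω / 2) ‖V (θ - θ*)‖²`. -/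
def upperError {Ω : Type*} [MeasurableSpace Ω] {p : ℕ} (μ : Measure Ω)
    (L : ParamSpace p → Ω → ℝ) (Θ : Set (ParamSpace p)) (V : Matrix (Fin p) (Fin p) ℝ)
    (θs : ParamSpace p) (ω r : ℝ) (w : Ω) : EReal :=
  ⨆ θ ∈ localSet Θ V θs r,
    ((linRemainder μ L Θ θs θ w - ω / 2 * matNorm V (θ - θs) ^ 2 : ℝ) : EReal)

/-- The lower bracketing error: the supremum over `Θ₀(r)`, in the extended reals, of
`-{ζ(θ, θ*) - (θ - θ*)ᵀ ∇ζ(θ*)} - (ω / 2) ‖V (θ - θ*)‖²`. -/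
def lowerError {Ω : Type*} [MeasurableSpace Ω] {p : ℕ} (μ : Measure Ω)
    (L : ParamSpace p → Ω → ℝ) (Θ : Set (ParamSpace p)) (V : Matrix (Fin p) (Fin p) ℝ)
    (θs : ParamSpace p) (ω r : ℝ) (w : Ω) : EReal :=
  ⨆ θ ∈ localSet Θ V θs r,
    ((-linRemainder μ L Θ θs θ w - ω / 2 * matNorm V (θ - θs) ^ 2 : ℝ) : EReal)

/-- The entropy constant: `2.7 p` for `p = 1` and `2 p` for `p ≥ 2`. -/
def entropyConst (p : ℕ) : ℝ := (if p = 1 then 2.7 else 2) * (p : ℝ)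

/-- The quantile bound `z_Q(x, Q)`, with `g₀ = g ν`. -/
def zQuant (g₀ x Q : ℝ) : ℝ :=
  if 1 + Real.sqrt (x + Q) ≤ g₀ then (1 + Real.sqrt (x + Q)) ^ 2
  else 1 + (2 * g₀⁻¹ * (x + Q) + g₀) ^ 2

end

/-! In the coordinates `u = V (θ - θs)`, let `X u` be plus or minus the linear remainder divided by
`ν * ρ r`. Since the local set is convex, an increment of `X` is the integral of its derivative
along a segment. Jensen's inequality and Tonelli's theorem then turn (ED₁) into `E exp (κ (X u - X
v)) ≤ exp (κ² ‖u - v‖² / 2)` whenever `κ ‖u - v‖ ≤ g * ν`.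

On a ball of radius `s`, dyadic chaining bounds the supremum of `X` (`measure_sup_ge_le`). Rather
than one union bound per link, all links enter a single convex combination of normalised
exponentials with mean at most `exp (-τ)`, to which Markov's inequality is applied once. The
restriction on `κ` does no harm: at each scale `κ` is taken so that `κ` times the link length is at
most the same `l`.

The quadratic penalty is handled by peeling into shells (`measure_penalized_sup_ge_le`): on distant
shells the penalty outgrows both the chaining bound and the cost `(j + 1) log 2` of summing over
shells. The two branches of `zQuant` correspond to taking `l` close to `1 + √(x + Q)`, or `l = g₀`
when that value is not admissible.

Finally `3 * ν * ρ r ≤ ω` turns a large bracketing error into `z + ‖u‖² / 2 ≤ X u / 3` for some `u`.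
-/

section

open scoped ENNReal Topology
open Filter Set

/-! ### Covering numbers of Euclidean balls. -/

/-- A subset of the closed ball of radius `R` whose points are `ε`-separated has at most
`(1 + 2 R / ε) ^ p` points. -/
lemma card_le_of_separated_of_norm_le {p : ℕ} {R ε : ℝ} (hR : 0 ≤ R) (hε : 0 < ε)
    (S : Finset (ParamSpace p)) (hS : ∀ u ∈ S, ‖u‖ ≤ R)
    (hsep : ∀ u ∈ S, ∀ v ∈ S, u ≠ v → ε ≤ dist u v) :
    (S.card : ℝ) ≤ (1 + 2 * R / ε) ^ p := by
  have hδ : 0 < ε / 2 := by positivity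
  have hρ : 0 < R + ε / 2 := by positivity
  let m : Measure (ParamSpace p) := volume
  -- Volume comparison: the balls of radius `ε / 2` about the points are disjoint and lie in the
  -- ball of radius `R + ε / 2`.
  have hdisj : Set.Pairwise (S : Set (ParamSpace p))
      (Function.onFun Disjoint fun c => Metric.ball c (ε / 2)) := by
    intro c hc d hd hcd
    apply Metric.ball_disjoint_ball
    linarith [hsep c hc d hd hcd]
  have hsub : (⋃ c ∈ S, Metric.ball c (ε / 2)) ⊆ Metric.ball (0 : ParamSpace p) (R + ε / 2) := by
    refine iUnion₂_subset fun u hu => Metric.ball_subset_ball' ?_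
    rw [dist_zero_right]
    linarith [hS u hu]
  have hvol : (S.card : ℝ≥0∞) * ENNReal.ofReal ((ε / 2) ^ p) * m (Metric.ball 0 1) ≤
      ENNReal.ofReal ((R + ε / 2) ^ p) * m (Metric.ball 0 1) := by
    calc _ = m (⋃ c ∈ S, Metric.ball c (ε / 2)) := by
          rw [measure_biUnion_finset hdisj fun c _ => measurableSet_ball]
          simp only [m.addHaar_ball_of_pos _ hδ, finrank_euclideanSpace, Fintype.card_fin]
          simp only [Finset.sum_const, nsmul_eq_mul, mul_assoc]
      _ ≤ m (Metric.ball 0 (R + ε / 2)) := measure_mono hsub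
      _ = _ := by
          simp only [m.addHaar_ball_of_pos _ hρ, finrank_euclideanSpace, Fintype.card_fin]
  have h2 : (S.card : ℝ≥0∞) * ENNReal.ofReal ((ε / 2) ^ p) ≤ ENNReal.ofReal ((R + ε / 2) ^ p) :=
    (ENNReal.mul_le_mul_iff_left (Metric.measure_ball_pos _ _ zero_lt_one).ne'
      measure_ball_lt_top.ne).1 hvol
  have h3 := ENNReal.toReal_le_of_le_ofReal (pow_nonneg hρ.le _) h2
  rw [ENNReal.toReal_mul, ENNReal.toReal_natCast, ENNReal.toReal_ofReal (by positivity)] at h3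
  have h4 : (1 + 2 * R / ε) ^ p = (R + ε / 2) ^ p / (ε / 2) ^ p := by
    rw [← div_pow]; congr 1; field_simp; ring
  rw [h4, le_div_iff₀ (by positivity)]
  exact h3

/-- A subset of the closed ball of radius `R` has an `ε`-net, consisting of points of the subset,
with at most `(1 + 2 R / ε) ^ p` points. -/
lemma exists_finset_net {p : ℕ} {R ε : ℝ} (hR : 0 ≤ R) (hε : 0 < ε)
    (A : Set (ParamSpace p)) (hA : ∀ u ∈ A, ‖u‖ ≤ R) :
    ∃ S : Finset (ParamSpace p), (∀ u ∈ S, u ∈ A) ∧ (S.card : ℝ) ≤ (1 + 2 * R / ε) ^ p ∧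
      ∀ u ∈ A, ∃ v ∈ S, dist u v ≤ ε := by
  classical
  let P : Finset (ParamSpace p) → Prop := fun S =>
    (∀ u ∈ S, u ∈ A) ∧ ∀ u ∈ S, ∀ v ∈ S, u ≠ v → ε ≤ dist u v
  have hcard : ∀ S, P S → (S.card : ℝ) ≤ (1 + 2 * R / ε) ^ p := fun S hS =>
    card_le_of_separated_of_norm_le hR hε S (fun u hu => hA u (hS.1 u hu)) hS.2
  let K : Set ℕ := {n | ∃ S, P S ∧ S.card = n}
  have hne : K.Nonempty := ⟨0, ∅, by simp [P], rfl⟩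
  have hbdd : BddAbove K := by
    refine ⟨⌊(1 + 2 * R / ε) ^ p⌋₊, ?_⟩
    rintro n ⟨S, hS, rfl⟩
    exact Nat.le_floor (hcard S hS)
  -- A separated subset of maximal cardinality is a net, since any uncovered point could be added to
  -- it.
  obtain ⟨S, hS, hSK⟩ := Nat.sSup_mem hne hbdd
  refine ⟨S, hS.1, hcard S hS, fun u hu => ?_⟩
  by_contra! hfar
  have huS : u ∉ S := fun h => by
    have := hfar u h
    rw [dist_self] at this
    linarith
  have hP : P (insert u S) := by
    refine ⟨fun v hv => ?_, fun v hv w hw hvw => ?_⟩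
    · rcases Finset.mem_insert.1 hv with rfl | h
      exacts [hu, hS.1 v h]
    · rcases Finset.mem_insert.1 hv with rfl | h <;> rcases Finset.mem_insert.1 hw with rfl | h'
      · exact absurd rfl hvw
      · exact (hfar w h').le
      · rw [dist_comm]; exact (hfar v h).le
      · exact hS.2 v h w h' hvw
  have h1 : (insert u S).card ≤ sSup K := le_csSup hbdd ⟨_, hP, rfl⟩
  rw [Finset.card_insert_of_notMem huS, hSK] at h1
  omega

variable {Ω : Type*} [MeasurableSpace Ω]

/-! ### Exponential moments of increments from those of the derivative. -/

/-- The derivative in time of a process that is almost surely differentiable on `[0, 1]` has a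
jointly measurable version on `(0, 1)`. -/
lemma exists_measurable_version_deriv {μ : Measure Ω} {F D : ℝ → Ω → ℝ}
    (hmeas : ∀ t ∈ Icc (0 : ℝ) 1, AEMeasurable (F t) μ)
    (hderiv : ∀ᵐ w ∂μ, ∀ t ∈ Icc (0 : ℝ) 1,
      HasDerivWithinAt (fun s => F s w) (D t w) (Icc 0 1) t) :
    ∃ D' : ℝ × Ω → ℝ, Measurable D' ∧ ∀ᵐ w ∂μ, ∀ t ∈ Ioo (0 : ℝ) 1, D' (t, w) = D t w := by
  have hex : ∀ n k : ℕ, ∃ a : Ω → ℝ, Measurable a ∧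
      ((k / n : ℝ) ∈ Icc (0 : ℝ) 1 → F (k / n) =ᵐ[μ] a) := by
    intro n k
    by_cases h : (k / n : ℝ) ∈ Icc (0 : ℝ) 1
    · exact ⟨(hmeas _ h).mk _, (hmeas _ h).measurable_mk, fun _ => (hmeas _ h).ae_eq_mk⟩
    · exact ⟨0, measurable_zero, fun h' => absurd h' h⟩
  choose a ham hae using hex
  have hA : ∀ n, Measurable fun q : ℝ × Ω => a n ⌊(q.1 * n : ℝ)⌋₊ q.2 := by
    intro n
    have h1 : Measurable fun q : ℕ × Ω => a n q.1 q.2 :=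
      measurable_from_prod_countable_right fun k => ham n k
    have h2 : Measurable fun q : ℝ × Ω => (⌊(q.1 * n : ℝ)⌋₊, q.2) :=
      (Nat.measurable_floor.comp (measurable_fst.mul_const _)).prodMk measurable_snd
    exact h1.comp h2
  -- Rounding time down to a grid gives joint measurability, and path continuity recovers `F` in the
  -- limit. A `limsup` is measurable even where the limit fails to exist; the same device defines
  -- `D'` from difference quotients.
  let G : ℝ × Ω → ℝ := fun q => limsup (fun n : ℕ => a n ⌊(q.1 * n : ℝ)⌋₊ q.2) atTop
  have hG : Measurable G := Measurable.limsup hA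
  let D' : ℝ × Ω → ℝ := fun q =>
    limsup (fun m : ℕ => (G (q.1 + 1 / ((m : ℝ) + 1), q.2) - G q) * ((m : ℝ) + 1)) atTop
  have hD' : Measurable D' := by
    refine Measurable.limsup fun m => ?_
    exact ((hG.comp ((measurable_fst.add_const _).prodMk measurable_snd)).sub hG).mul_const _
  refine ⟨D', hD', ?_⟩
  have hae' : ∀ᵐ w ∂μ, ∀ n k : ℕ, (k / n : ℝ) ∈ Icc (0 : ℝ) 1 → F (k / n) w = a n k w := by
    refine ae_all_iff.2 fun n => ae_all_iff.2 fun k => ?_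
    by_cases h : (k / n : ℝ) ∈ Icc (0 : ℝ) 1
    · filter_upwards [hae n k h] with w hw _ using hw
    · exact Eventually.of_forall fun w h' => absurd h' h
  filter_upwards [hderiv, hae'] with w hw hwa
  have hGF : ∀ t ∈ Icc (0 : ℝ) 1, G (t, w) = F t w := by
    intro t ht
    have hin : ∀ n : ℕ, (⌊(t * n : ℝ)⌋₊ / n : ℝ) ∈ Icc (0 : ℝ) 1 := by
      intro n
      refine ⟨by positivity, ?_⟩
      have h1 : (⌊(t * n : ℝ)⌋₊ : ℝ) ≤ t * n := Nat.floor_le (mul_nonneg ht.1 n.cast_nonneg)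
      refine div_le_one_of_le₀ (h1.trans ?_) n.cast_nonneg
      exact mul_le_of_le_one_left n.cast_nonneg ht.2
    have hlim : Tendsto (fun n : ℕ => (⌊(t * n : ℝ)⌋₊ / n : ℝ)) atTop (𝓝[Icc 0 1] t) :=
      tendsto_nhdsWithin_iff.2
        ⟨(tendsto_nat_floor_mul_div_atTop ht.1).comp tendsto_natCast_atTop_atTop,
          Eventually.of_forall hin⟩
    have hc : Tendsto (fun n : ℕ => F (⌊(t * n : ℝ)⌋₊ / n : ℝ) w) atTop (𝓝 (F t w)) :=
      ((hw t ht).continuousWithinAt.tendsto).comp hlim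
    refine Tendsto.limsup_eq (hc.congr fun n => ?_)
    exact hwa n _ (hin n)
  intro t ht
  have htI : t ∈ Icc (0 : ℝ) 1 := Ioo_subset_Icc_self ht
  have hd : HasDerivAt (fun s => F s w) (D t w) t :=
    (hw t htI).hasDerivAt (Icc_mem_nhds ht.1 ht.2)
  have hseq : Tendsto (fun m : ℕ => t + 1 / ((m : ℝ) + 1)) atTop (𝓝[≠] t) := by
    refine tendsto_nhdsWithin_iff.2 ⟨?_, Eventually.of_forall fun m => ?_⟩
    · simpa using tendsto_const_nhds.add (tendsto_one_div_add_atTop_nhds_zero_nat (𝕜 := ℝ))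
    · have : (0 : ℝ) < 1 / ((m : ℝ) + 1) := by positivity
      simp only [mem_compl_iff, mem_singleton_iff]
      linarith
  have hslope := (hasDerivAt_iff_tendsto_slope.1 hd).comp hseq
  have hev : ∀ᶠ m : ℕ in atTop, t + 1 / ((m : ℝ) + 1) ∈ Icc (0 : ℝ) 1 :=
    (tendsto_nhdsWithin_iff.1 hseq).1.eventually (Icc_mem_nhds ht.1 ht.2)
  refine Tendsto.limsup_eq (hslope.congr' ?_)
  filter_upwards [hev] with m hm
  simp only [Function.comp_apply, slope_def_field, hGF t htI, hGF _ hm]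
  have : (0 : ℝ) < (m : ℝ) + 1 := by positivity
  field_simp
  ring

/-- Exponential moments of the increment of an almost surely differentiable process are bounded by
those of its derivative. -/
lemma lintegral_exp_increment_le {μ : Measure Ω} [IsProbabilityMeasure μ] {F D : ℝ → Ω → ℝ}
    (hmeas : ∀ t ∈ Icc (0 : ℝ) 1, AEMeasurable (F t) μ)
    (hderiv : ∀ᵐ w ∂μ, ∀ t ∈ Icc (0 : ℝ) 1,
      HasDerivWithinAt (fun s => F s w) (D t w) (Icc 0 1) t)
    {a κ : ℝ} (ha : 0 < a) {C₀ C : ℝ≥0∞} (hC₀ : C₀ ≠ ⊤)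
    (hpos : ∀ t ∈ Icc (0 : ℝ) 1, ∫⁻ w, ENNReal.ofReal (Real.exp (a * D t w)) ∂μ ≤ C₀)
    (hneg : ∀ t ∈ Icc (0 : ℝ) 1, ∫⁻ w, ENNReal.ofReal (Real.exp (-a * D t w)) ∂μ ≤ C₀)
    (hκ : ∀ t ∈ Icc (0 : ℝ) 1, ∫⁻ w, ENNReal.ofReal (Real.exp (κ * D t w)) ∂μ ≤ C) :
    ∫⁻ w, ENNReal.ofReal (Real.exp (κ * (F 1 w - F 0 w))) ∂μ ≤ C := by
  obtain ⟨D', hD', hDD'⟩ := exists_measurable_version_deriv hmeas hderiv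
  let I : Measure ℝ := volume.restrict (Ioo 0 1)
  have hI : IsProbabilityMeasure I := ⟨by simp [I]⟩
  have hswap : ∀ (f : ℝ → ℝ≥0∞), Measurable f → ∀ K : ℝ≥0∞,
      (∀ t ∈ Icc (0 : ℝ) 1, ∫⁻ w, f (D t w) ∂μ ≤ K) →
      ∫⁻ w, ∫⁻ t, f (D' (t, w)) ∂I ∂μ ≤ K := by
    intro f hf K hK
    rw [lintegral_lintegral_swap (f := fun w t => f (D' (t, w)))
      (hf.comp (hD'.comp measurable_swap)).aemeasurable]
    calc ∫⁻ t, ∫⁻ w, f (D' (t, w)) ∂μ ∂I ≤ ∫⁻ _, K ∂I := by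
          refine lintegral_mono_ae ?_
          filter_upwards [ae_restrict_mem measurableSet_Ioo] with t ht
          refine le_trans (le_of_eq (lintegral_congr_ae ?_)) (hK t (Ioo_subset_Icc_self ht))
          filter_upwards [hDD'] with w hw
          rw [hw t ht]
      _ = K := by simp
  have hexp : ∀ b : ℝ, Measurable fun y : ℝ => ENNReal.ofReal (Real.exp (b * y)) := fun b => by
    fun_prop
  -- The two-sided moments of order `a` serve only to make almost every path of the derivative
  -- integrable, as the fundamental theorem of calculus requires.
  have hle : ∀ y : ℝ, ‖y‖ₑ ≤ ENNReal.ofReal a⁻¹ *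
      (ENNReal.ofReal (Real.exp (a * y)) + ENNReal.ofReal (Real.exp (-a * y))) := by
    intro y
    rw [← ENNReal.ofReal_add (Real.exp_pos _).le (Real.exp_pos _).le,
      ← ENNReal.ofReal_mul (by positivity), Real.enorm_eq_ofReal_abs]
    refine ENNReal.ofReal_le_ofReal ?_
    rw [inv_mul_eq_div, le_div_iff₀ ha]
    rcases abs_cases y with ⟨h, _⟩ | ⟨h, _⟩ <;> rw [h]
    · linarith [Real.add_one_le_exp (a * y), Real.exp_pos (-a * y)]
    · linarith [Real.add_one_le_exp (-a * y), Real.exp_pos (a * y)]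
  have hfin : ∀ b : ℝ, (∀ t ∈ Icc (0 : ℝ) 1,
      ∫⁻ w, ENNReal.ofReal (Real.exp (b * D t w)) ∂μ ≤ C₀) →
      ∀ᵐ w ∂μ, ∫⁻ t, ENNReal.ofReal (Real.exp (b * D' (t, w))) ∂I < ⊤ := fun b hb =>
    ae_lt_top (Measurable.lintegral_prod_left' ((hexp b).comp hD'))
      (ne_top_of_le_ne_top hC₀ (hswap _ (hexp b) C₀ hb))
  refine le_trans (lintegral_mono_ae ?_) (hswap _ (hexp κ) C hκ)
  filter_upwards [hderiv, hDD', hfin a hpos, hfin (-a) hneg] with w hw hwD hp hn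
  have hDm : Measurable fun t => D' (t, w) := hD'.comp measurable_prodMk_right
  have hint : Integrable (fun t => D' (t, w)) I := by
    refine ⟨hDm.aestronglyMeasurable, ?_⟩
    calc ∫⁻ t, ‖D' (t, w)‖ₑ ∂I ≤ _ := lintegral_mono fun t => hle (D' (t, w))
      _ = ENNReal.ofReal a⁻¹ * (∫⁻ t, ENNReal.ofReal (Real.exp (a * D' (t, w))) ∂I +
          ∫⁻ t, ENNReal.ofReal (Real.exp (-a * D' (t, w))) ∂I) := by
        rw [lintegral_const_mul' _ _ ENNReal.ofReal_ne_top,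
          lintegral_add_left (f := fun t => ENNReal.ofReal (Real.exp (a * D' (t, w))))
            ((hexp a).comp hDm)]
      _ < ⊤ := ENNReal.mul_lt_top ENNReal.ofReal_lt_top (ENNReal.add_lt_top.2 ⟨hp, hn⟩)
  have hftc : F 1 w - F 0 w = ∫ t, D' (t, w) ∂I := by
    have h1 : IntervalIntegrable (fun t => D' (t, w)) volume 0 1 :=
      (intervalIntegrable_iff_integrableOn_Ioo_of_le zero_le_one).2 hint
    rw [← intervalIntegral.integral_eq_sub_of_hasDerivAt_of_le (f := fun s => F s w) zero_le_one
      (fun t ht => (hw t ht).continuousWithinAt)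
      (fun t ht => by
        rw [hwD t ht]
        exact (hw t (Ioo_subset_Icc_self ht)).hasDerivAt (Icc_mem_nhds ht.1 ht.2)) h1,
      intervalIntegral.integral_of_le zero_le_one, integral_Ioc_eq_integral_Ioo]
  by_cases htop : ∫⁻ t, ENNReal.ofReal (Real.exp (κ * D' (t, w))) ∂I = ⊤
  · rw [htop]; exact le_top
  have hexpint : Integrable (fun t => Real.exp (κ * D' (t, w))) I := by
    refine ⟨(Real.measurable_exp.comp (hDm.const_mul κ)).aestronglyMeasurable, ?_⟩
    rw [hasFiniteIntegral_iff_ofReal (Eventually.of_forall fun t => (Real.exp_pos _).le)]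
    exact lt_top_iff_ne_top.2 htop
  rw [← ofReal_integral_eq_lintegral_ofReal hexpint
    (Eventually.of_forall fun t => (Real.exp_pos _).le), hftc, ← integral_const_mul]
  -- Jensen's inequality for the uniform law on `(0, 1)`.
  exact ENNReal.ofReal_le_ofReal (convexOn_exp.map_integral_le Real.continuous_exp.continuousOn
    isClosed_univ (Eventually.of_forall fun t => mem_univ _) (hint.const_mul κ) hexpint)

/-! ### Dyadic chaining. -/

/-- The logarithmic covering bound of the ball at scale `2 ^ (-(j + 1))` per dimension. -/
lemma one_add_two_pow_le_exp (j : ℕ) :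
    (1 + 2 ^ (j + 2) : ℝ) ≤ Real.exp ((j + 2) * Real.log 2 + (1 / 2) ^ (j + 2)) := by
  have h1 : Real.exp ((j + 2) * Real.log 2) = 2 ^ (j + 2) := by
    rw [← Real.rpow_natCast, Real.rpow_def_of_pos two_pos]
    push_cast
    ring_nf
  rw [Real.exp_add, h1]
  have h2 := Real.add_one_le_exp ((1 / 2 : ℝ) ^ (j + 2))
  have h3 : (2 : ℝ) ^ (j + 2) * (1 / 2) ^ (j + 2) = 1 := by
    rw [← mul_pow]; norm_num
  have h4 := mul_le_mul_of_nonneg_left h2 (pow_nonneg (zero_le_two (α := ℝ)) (j + 2))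
  linarith

/-- The entropy sum of the dyadic chaining. -/
lemma sum_entropy_le (l d : ℝ) (hd : 0 ≤ d) (k : ℕ) :
    ∑ j ∈ Finset.range k, (1 / 2 : ℝ) ^ (j + 1) *
      (l ^ 2 / 2 + d * ((j + 2) * Real.log 2 + (1 / 2) ^ (j + 2))) ≤ l ^ 2 / 2 + 9 / 4 * d := by
  have hclosed : ∀ k : ℕ, ∑ j ∈ Finset.range k, (1 / 2 : ℝ) ^ (j + 1) *
      (l ^ 2 / 2 + d * ((j + 2) * Real.log 2 + (1 / 2) ^ (j + 2))) =
      (1 - (1 / 2) ^ k) * (l ^ 2 / 2) + d * (Real.log 2 * (3 - (k + 3) * (1 / 2) ^ k) +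
        (1 - ((1 / 2) ^ k) ^ 2) / 6) := by
    intro k
    induction k with
    | zero => simp
    | succ k ih =>
      rw [Finset.sum_range_succ, ih]
      push_cast
      ring
  rw [hclosed]
  have hk : (0 : ℝ) < (1 / 2) ^ k := by positivity
  have hlog := Real.log_two_lt_d9
  have hlog0 := Real.log_two_gt_d9
  have h1 : (1 - (1 / 2 : ℝ) ^ k) * (l ^ 2 / 2) ≤ l ^ 2 / 2 := by nlinarith [sq_nonneg l]
  -- The limit in `k` is `3 log 2 + 1 / 6 ≈ 2.246`, which is where the constant `9 / 4` comes from.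
  have h2 : Real.log 2 * (3 - (k + 3) * (1 / 2) ^ k) + (1 - ((1 / 2 : ℝ) ^ k) ^ 2) / 6 ≤ 9 / 4 := by
    have h3 : Real.log 2 * (3 - (k + 3) * (1 / 2) ^ k) ≤ Real.log 2 * 3 := by
      refine mul_le_mul_of_nonneg_left ?_ (by linarith)
      have : (0 : ℝ) ≤ (k + 3) * (1 / 2) ^ k := by positivity
      linarith
    have : 0 ≤ ((1 / 2 : ℝ) ^ k) ^ 2 := sq_nonneg _
    linarith
  nlinarith

/-- **Dyadic chaining**: an exponential deviation bound for the supremum, over a subset of a ball,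
of a process whose increments have sub-Gaussian exponential moments of bounded order. -/
lemma measure_sup_ge_le {μ : Measure Ω} {p : ℕ} {X : ParamSpace p → Ω → ℝ}
    {A : Set (ParamSpace p)} {s : ℝ} (hs : 0 < s) (h0 : 0 ∈ A) (hA : ∀ u ∈ A, ‖u‖ ≤ s)
    (hX0 : ∀ w, X 0 w = 0) (hmeas : ∀ u ∈ A, AEMeasurable (X u) μ)
    (hcont : ∀ᵐ w ∂μ, ContinuousOn (fun u => X u w) A) {l : ℝ} (hl : 0 ≤ l) (τ : ℝ)
    (hinc : ∀ u ∈ A, ∀ v ∈ A, ∀ κ : ℝ, 0 ≤ κ → κ * dist u v ≤ l →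
      ∫⁻ w, ENNReal.ofReal (Real.exp (κ * (X u w - X v w))) ∂μ ≤
        ENNReal.ofReal (Real.exp ((κ * dist u v) ^ 2 / 2))) :
    μ {w | ∃ u ∈ A, l ^ 2 / 2 + 9 / 4 * p + τ ≤ l * X u w / (2 * s)} ≤
      ENNReal.ofReal (Real.exp (-τ)) := by
  have hnet : ∀ k : ℕ, ∃ S : Finset (ParamSpace p), (k = 0 → S = {0}) ∧ (∀ u ∈ S, u ∈ A) ∧
      (S.card : ℝ) ≤ (1 + 2 ^ (k + 1)) ^ p ∧ ∀ u ∈ A, ∃ v ∈ S, dist u v ≤ s / 2 ^ k := by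
    intro k
    rcases Nat.eq_zero_or_pos k with rfl | hk
    · refine ⟨{0}, fun _ => rfl, by simpa using h0, ?_, fun u hu => ⟨0, by simp, ?_⟩⟩
      · simp only [Finset.card_singleton, Nat.cast_one]
        exact one_le_pow₀ (by norm_num)
      · simpa using hA u hu
    · obtain ⟨S, h1, h2, h3⟩ := exists_finset_net hs.le (ε := s / 2 ^ k) (by positivity) A hA
      refine ⟨S, fun h => absurd h hk.ne', h1, h2.trans (le_of_eq ?_), h3⟩
      congr 2
      field_simp
      ring
  choose S hS0 hSA hScard hSnet using hnet
  have hpar : ∀ (k : ℕ) (u : ParamSpace p), ∃ v, u ∈ A → v ∈ S k ∧ dist u v ≤ s / 2 ^ k := by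
    intro k u
    by_cases hu : u ∈ A
    · obtain ⟨v, hv⟩ := hSnet k u hu
      exact ⟨v, fun _ => hv⟩
    · exact ⟨u, fun h => absurd h hu⟩
  choose π hπ using hpar
  -- `a j` adds the log-moment bound of one link to the log-cardinality of the net `S (j + 1)`. `κ
  -- j` is scaled so that a link of maximal length `s / 2 ^ j` has `κ j * (s / 2 ^ j) = l`. The
  -- weights `c j` sum to one and make `c j * κ j = l / (2 * s)` independent of `j`, so the weighted
  -- links telescope.
  let a : ℕ → ℝ := fun j => l ^ 2 / 2 + p * ((j + 2) * Real.log 2 + (1 / 2) ^ (j + 2))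
  let κ : ℕ → ℝ := fun j => l * 2 ^ j / s
  have hκ0 : ∀ j, 0 ≤ κ j := fun j => by positivity
  let c : ℕ → ℝ := fun j => (1 / 2) ^ (j + 1)
  have hc0 : ∀ j, 0 ≤ c j := fun j => by positivity
  let y : ℕ → ParamSpace p → Ω → ℝ := fun j u w =>
    Real.exp (κ j * (X u w - X (π j u) w)) * Real.exp (-(a j + τ))
  let Y : ℕ → Ω → ℝ := fun j w => ∑ u ∈ S (j + 1), y j u w
  have hY0 : ∀ j w, 0 ≤ Y j w := fun j w => Finset.sum_nonneg fun u _ => by positivity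
  have hym : ∀ j, ∀ u ∈ S (j + 1), AEMeasurable (y j u) μ := by
    intro j u hu
    have h1 := hmeas u (hSA _ u hu)
    have h2 := hmeas (π j u) (hSA _ _ (hπ j u (hSA _ u hu)).1)
    exact (Real.measurable_exp.comp_aemeasurable ((h1.sub h2).const_mul _)).mul_const _
  have hYm : ∀ j, AEMeasurable (Y j) μ := fun j => Finset.aemeasurable_fun_sum _ (hym j)
  have hYint : ∀ j, ∫⁻ w, ENNReal.ofReal (Y j w) ∂μ ≤ ENNReal.ofReal (Real.exp (-τ)) := by
    intro j
    have h1 : ∀ u ∈ S (j + 1), ∫⁻ w, ENNReal.ofReal (y j u w) ∂μ ≤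
        ENNReal.ofReal (Real.exp (l ^ 2 / 2 - (a j + τ))) := by
      intro u hu
      have huA := hSA _ u hu
      obtain ⟨hv, hd⟩ := hπ j u huA
      have hκd : κ j * dist u (π j u) ≤ l := by
        calc κ j * dist u (π j u) ≤ κ j * (s / 2 ^ j) := by gcongr
          _ = l := by simp only [κ]; field_simp
      simp only [y]
      simp_rw [ENNReal.ofReal_mul (Real.exp_pos _).le]
      rw [lintegral_mul_const' _ _ ENNReal.ofReal_ne_top, sub_eq_add_neg, Real.exp_add,
        ENNReal.ofReal_mul (Real.exp_pos _).le]
      gcongr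
      refine (hinc u huA _ (hSA _ _ hv) _ (hκ0 j) hκd).trans (ENNReal.ofReal_le_ofReal ?_)
      have : 0 ≤ κ j * dist u (π j u) := mul_nonneg (hκ0 j) dist_nonneg
      gcongr
    have hcard : ((S (j + 1)).card : ℝ) ≤
        Real.exp (p * ((j + 2) * Real.log 2 + (1 / 2) ^ (j + 2))) := by
      rw [Real.exp_nat_mul]
      refine (hScard (j + 1)).trans ?_
      gcongr
      exact one_add_two_pow_le_exp j
    calc ∫⁻ w, ENNReal.ofReal (Y j w) ∂μ
        = ∑ u ∈ S (j + 1), ∫⁻ w, ENNReal.ofReal (y j u w) ∂μ := by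
          rw [← lintegral_finsetSum' _ fun u hu => (hym j u hu).ennreal_ofReal]
          refine lintegral_congr fun w => ?_
          exact ENNReal.ofReal_sum_of_nonneg fun u _ => by positivity
      _ ≤ ∑ _u ∈ S (j + 1), ENNReal.ofReal (Real.exp (l ^ 2 / 2 - (a j + τ))) :=
          Finset.sum_le_sum h1
      _ = ENNReal.ofReal ((S (j + 1)).card * Real.exp (l ^ 2 / 2 - (a j + τ))) := by
          rw [Finset.sum_const, nsmul_eq_mul, ENNReal.ofReal_mul (Nat.cast_nonneg _),
            ENNReal.ofReal_natCast]
      _ ≤ ENNReal.ofReal (Real.exp (-τ)) := by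
          refine ENNReal.ofReal_le_ofReal ?_
          calc _ ≤ Real.exp (p * ((j + 2) * Real.log 2 + (1 / 2) ^ (j + 2))) *
                Real.exp (l ^ 2 / 2 - (a j + τ)) := by gcongr
            _ = Real.exp (-τ) := by
                rw [← Real.exp_add]; congr 1; simp only [a]; ring
  -- A convex combination of the `Y j`, so its mean is still at most `exp (-τ)`.
  let Z : Ω → ℝ≥0∞ := fun w => ∑' j, ENNReal.ofReal (c j * Y j w)
  have hZm : AEMeasurable Z μ :=
    AEMeasurable.tsum fun j => ((hYm j).const_mul _).ennreal_ofReal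
  have hcsum : ∑' j, ENNReal.ofReal (c j) = 1 := by
    have h1 : HasSum c 1 := by
      have := hasSum_geometric_two.mul_left (1 / 2 : ℝ)
      simp only [c, pow_succ']
      simpa using this
    rw [← ENNReal.ofReal_tsum_of_nonneg hc0 h1.summable, h1.tsum_eq, ENNReal.ofReal_one]
  have hZint : ∫⁻ w, Z w ∂μ ≤ ENNReal.ofReal (Real.exp (-τ)) := by
    simp only [Z]
    rw [lintegral_tsum fun j => ((hYm j).const_mul _).ennreal_ofReal]
    calc _ ≤ ∑' j, ENNReal.ofReal (c j) * ENNReal.ofReal (Real.exp (-τ)) := by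
          refine ENNReal.tsum_le_tsum fun j => ?_
          simp_rw [ENNReal.ofReal_mul (hc0 j)]
          rw [lintegral_const_mul' _ _ ENNReal.ofReal_ne_top]
          gcongr
          exact hYint j
      _ = _ := by rw [ENNReal.tsum_mul_right, hcsum, one_mul]
  have hmarkov : μ {w | 1 ≤ Z w} ≤ ENNReal.ofReal (Real.exp (-τ)) := by
    have := mul_meas_ge_le_lintegral₀ hZm 1
    rw [one_mul] at this
    exact this.trans hZint
  refine le_trans (measure_mono_ae ?_) hmarkov
  filter_upwards [hcont] with w hw
  rintro ⟨u, hu, hlarge⟩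
  change 1 ≤ Z w
  by_contra! hZ
  have hpart : ∀ k, ∑ j ∈ Finset.range k, c j * Y j w ≤ (Z w).toReal := by
    intro k
    have h1 : ENNReal.ofReal (∑ j ∈ Finset.range k, c j * Y j w) ≤ Z w := by
      rw [ENNReal.ofReal_sum_of_nonneg fun j _ => mul_nonneg (hc0 j) (hY0 j w)]
      exact ENNReal.sum_le_tsum _
    exact (ENNReal.ofReal_le_iff_le_toReal (hZ.trans ENNReal.one_lt_top).ne).1 h1
  have hZ1 : (Z w).toReal < 1 := by
    have := (ENNReal.toReal_lt_toReal (hZ.trans ENNReal.one_lt_top).ne ENNReal.one_ne_top).2 hZ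
    simpa using this
  -- The inequality `1 + y ≤ exp y` bounds each link linearly by `Y k`. The `-1` it yields, summed
  -- against the weights, offsets `Z < 1` at the end.
  have hchain : ∀ k, ∀ v ∈ S k, l * X v w / (2 * s) ≤
      ∑ j ∈ Finset.range k, c j * (a j + (τ - 1) + Y j w) := by
    intro k
    induction k with
    | zero =>
      intro v hv
      rw [hS0 0 rfl, Finset.mem_singleton] at hv
      simp [hv, hX0]
    | succ k ih =>
      intro v hv
      rw [Finset.sum_range_succ]
      have h1 := ih (π k v) (hπ k v (hSA _ v hv)).1
      have h2 : κ k * (X v w - X (π k v) w) ≤ a k + (τ - 1) + Y k w := by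
        have h3 : y k v w ≤ Y k w :=
          Finset.single_le_sum (f := fun u => y k u w) (fun u _ => by positivity) hv
        have h4 : κ k * (X v w - X (π k v) w) + -(a k + τ) + 1 ≤ y k v w := by
          simp only [y]
          rw [← Real.exp_add]
          exact Real.add_one_le_exp _
        linarith
      have h5 : c k * (κ k * (X v w - X (π k v) w)) =
          l * X v w / (2 * s) - l * X (π k v) w / (2 * s) := by
        have h6 : c k * κ k = l / (2 * s) := by
          simp only [c, κ]
          rw [one_div, inv_pow, pow_succ]
          field_simp
        rw [← mul_assoc, h6]
        ring
      have h7 := mul_le_mul_of_nonneg_left h2 (hc0 k)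
      linarith
  have hbound : ∀ k, l * X (π k u) w / (2 * s) ≤
      l ^ 2 / 2 + 9 / 4 * p + (τ - 1) * (1 - (1 / 2) ^ k) + (Z w).toReal := by
    intro k
    refine (hchain k _ (hπ k u hu).1).trans ?_
    have h1 : ∑ j ∈ Finset.range k, c j = 1 - (1 / 2) ^ k := by
      clear hpart hchain
      induction k with
      | zero => simp
      | succ k ih => rw [Finset.sum_range_succ, ih]; simp only [c]; ring
    have h2 : ∑ j ∈ Finset.range k, c j * (a j + (τ - 1) + Y j w) =
        ∑ j ∈ Finset.range k, c j * a j + (τ - 1) * ∑ j ∈ Finset.range k, c j +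
          ∑ j ∈ Finset.range k, c j * Y j w := by
      rw [Finset.mul_sum, ← Finset.sum_add_distrib, ← Finset.sum_add_distrib]
      exact Finset.sum_congr rfl fun j _ => by ring
    rw [h2, h1]
    have h3 := sum_entropy_le l p (Nat.cast_nonneg _) k
    have h4 := hpart k
    simp only [c, a] at h3 h4 ⊢
    linarith
  have hgeo : Tendsto (fun k : ℕ => (1 / 2 : ℝ) ^ k) atTop (𝓝 0) :=
    tendsto_pow_atTop_nhds_zero_of_lt_one (by norm_num) (by norm_num)
  have hπlim : Tendsto (fun k => π k u) atTop (𝓝[A] u) := by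
    refine tendsto_nhdsWithin_iff.2 ⟨?_, Eventually.of_forall fun k => hSA _ _ (hπ k u hu).1⟩
    rw [tendsto_iff_dist_tendsto_zero]
    have h1 : Tendsto (fun k : ℕ => s * (1 / 2 : ℝ) ^ k) atTop (𝓝 0) := by
      simpa using hgeo.const_mul s
    refine squeeze_zero (fun _ => dist_nonneg) (fun k => ?_) h1
    rw [dist_comm]
    refine (hπ k u hu).2.trans (le_of_eq ?_)
    rw [one_div, inv_pow, div_eq_mul_inv]
  have hlimX : Tendsto (fun k => l * X (π k u) w / (2 * s)) atTop (𝓝 (l * X u w / (2 * s))) :=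
    (((hw u hu).tendsto.comp hπlim).const_mul l).div_const _
  have hlimB : Tendsto (fun k : ℕ => l ^ 2 / 2 + 9 / 4 * p + (τ - 1) * (1 - (1 / 2 : ℝ) ^ k) +
      (Z w).toReal) atTop (𝓝 (l ^ 2 / 2 + 9 / 4 * p + (τ - 1) * (1 - 0) + (Z w).toReal)) :=
    (((hgeo.const_sub 1).const_mul _).const_add _).add_const _
  have := le_of_tendsto_of_tendsto' hlimX hlimB hbound
  linarith

/-! ### Peeling and numerical constants. -/

/-- This is where the value of the entropy constant enters: it must absorb the chaining entropy `9 /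
4 * p` and the cost `7 log 2` of the seventh shell. -/
lemma entropyConst_lower_bounds {p : ℕ} (hp : 1 ≤ p) {x K : ℝ} (hx : 0 ≤ x)
    (hK : 49 / 50 * (1 + Real.sqrt (x + entropyConst p)) ^ 2 ≤ K) :
    6 ≤ K ∧ 9 / 4 * p + x + 7 * Real.log 2 ≤ 23 / 20 * K := by
  have hlog := Real.log_two_lt_d9
  have hp1 : (1 : ℝ) ≤ p := by exact_mod_cast hp
  have hQ0 : 0 ≤ entropyConst p := by unfold entropyConst; positivity
  have hsq : Real.sqrt (x + entropyConst p) ^ 2 = x + entropyConst p := Real.sq_sqrt (by linarith)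
  rcases hp.eq_or_lt with rfl | h2
  · have hQ : entropyConst 1 = 2.7 := by simp [entropyConst]
    have hσ : 1.64 ≤ Real.sqrt (x + entropyConst 1) := by
      apply Real.le_sqrt_of_sq_le
      rw [hQ]; norm_num at *; linarith
    rw [hQ] at hsq hσ hK
    push_cast
    constructor <;> norm_num at * <;> nlinarith
  · have hQ : entropyConst p = 2 * p := by simp [entropyConst, h2.ne']
    have hp2 : (2 : ℝ) ≤ p := by exact_mod_cast h2
    have hσ : 2 ≤ Real.sqrt (x + entropyConst p) := by
      apply Real.le_sqrt_of_sq_le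
      rw [hQ]; linarith
    constructor <;> nlinarith

/-- For `j ≤ 6` the uniform bound on `f` suffices, because `1 / 2 + 23 / 20 = 3 / 2 * (11 / 10)`.
Beyond that, the linear growth of `f` outpaces `j log 2`, as `K ≥ 6`. -/
lemma peeling_exponent_le {p : ℕ} {x K f : ℝ} (j : ℕ) (hK6 : 6 ≤ K)
    (hK : 9 / 4 * p + x + 7 * Real.log 2 ≤ 23 / 20 * K) (hf : 11 / 10 ≤ f)
    (hfj : 3 / 20 * j + 3 / 20 ≤ f) :
    K / 2 + 9 / 4 * p + (x + (j + 1) * Real.log 2) ≤ 3 / 2 * K * f := by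
  have hlog := Real.log_two_lt_d9
  have hlog0 := Real.log_two_gt_d9
  rcases le_or_gt j 6 with hj | hj
  · have hj' : (j : ℝ) ≤ 6 := by exact_mod_cast hj
    nlinarith
  · have hj' : (7 : ℝ) ≤ j := by exact_mod_cast hj
    nlinarith

/-- A quadratically penalized version of `measure_sup_ge_le`, by peeling. -/
lemma measure_penalized_sup_ge_le {μ : Measure Ω} {p : ℕ} (hp : 1 ≤ p)
    {X : ParamSpace p → Ω → ℝ} {B : Set (ParamSpace p)} (h0 : 0 ∈ B)
    (hX0 : ∀ w, X 0 w = 0) (hmeas : ∀ u ∈ B, AEMeasurable (X u) μ)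
    (hcont : ∀ᵐ w ∂μ, ContinuousOn (fun u => X u w) B) {l q x : ℝ} (hl : 0 ≤ l) (hlq : l ≤ q)
    (hq : 0 < q) (hx : 0 ≤ x)
    (hK : 49 / 50 * (1 + Real.sqrt (x + entropyConst p)) ^ 2 ≤ l * q)
    (hinc : ∀ u ∈ B, ∀ v ∈ B, ∀ κ : ℝ, 0 ≤ κ → κ * dist u v ≤ l →
      ∫⁻ w, ENNReal.ofReal (Real.exp (κ * (X u w - X v w))) ∂μ ≤
        ENNReal.ofReal (Real.exp ((κ * dist u v) ^ 2 / 2))) :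
    μ {w | ∃ u ∈ B, q ^ 2 + ‖u‖ ^ 2 / 2 ≤ X u w / 3} ≤ ENNReal.ofReal (Real.exp (-x)) := by
  obtain ⟨hK6, hKp⟩ := entropyConst_lower_bounds hp hx hK
  let t : ℕ → ℝ := fun j => 9 / 10 + 3 / 10 * j
  have ht : ∀ j, 9 / 10 ≤ t j := fun j => by
    have : (0 : ℝ) ≤ j := j.cast_nonneg
    simp only [t]; linarith
  have ht0 : ∀ j, 0 < t j := fun j => by linarith [ht j]
  let τ : ℕ → ℝ := fun j => x + (j + 1) * Real.log 2
  let E : ℕ → Set Ω := fun j => {w | ∃ u ∈ B ∩ Metric.closedBall 0 (q * t j),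
    l ^ 2 / 2 + 9 / 4 * p + τ j ≤ l * X u w / (2 * (q * t j))}
  have hE : ∀ j, μ (E j) ≤ ENNReal.ofReal (Real.exp (-τ j)) := fun j => by
    have hs : 0 < q * t j := mul_pos hq (ht0 j)
    refine measure_sup_ge_le (A := B ∩ Metric.closedBall 0 (q * t j)) hs
      ⟨h0, by simpa using hs.le⟩ (fun u hu => by simpa using hu.2) hX0
      (fun u hu => hmeas u hu.1) ?_ hl _ fun u hu v hv => hinc u hu.1 v hv.1
    filter_upwards [hcont] with w hw using hw.mono inter_subset_left
  have hsub : {w | ∃ u ∈ B, q ^ 2 + ‖u‖ ^ 2 / 2 ≤ X u w / 3} ⊆ ⋃ j, E j := by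
    rintro w ⟨u, hu, hlarge⟩
    have hex : ∃ j, ‖u‖ ≤ q * t j := by
      obtain ⟨j, hj⟩ := exists_nat_ge (‖u‖ / q * 4)
      refine ⟨j, ?_⟩
      have h1 : ‖u‖ = q * (‖u‖ / q) := by field_simp
      rw [h1]
      refine mul_le_mul_of_nonneg_left ?_ hq.le
      simp only [t]
      have : (0 : ℝ) ≤ ‖u‖ / q := by positivity
      linarith
    classical
    let j := Nat.find hex
    have hj : ‖u‖ ≤ q * t j := Nat.find_spec hex
    -- `f` compares the smallest penalty on the shell with its outer radius: `1 / t 0 = 10 / 9` on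
    -- the inner ball, `(1 + t (j - 1) ^ 2 / 2) / t j` outside it. The uniform bound is tightest at
    -- `t j = 7 / 5`.
    have key : ∃ f : ℝ, 11 / 10 ≤ f ∧ 3 / 20 * j + 3 / 20 ≤ f ∧ q * f * (q * t j) ≤ X u w / 3 := by
      rcases Nat.eq_zero_or_pos j with h | h
      · refine ⟨10 / 9, by norm_num, by rw [h]; norm_num, ?_⟩
        have h1 : t j = 9 / 10 := by simp [t, h]
        rw [h1]
        nlinarith [sq_nonneg ‖u‖]
      · have hprev : q * t (j - 1) < ‖u‖ := not_le.1 (Nat.find_min hex (Nat.sub_lt h one_pos))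
        have htj : t (j - 1) = t j - 3 / 10 := by
          simp only [t]
          rw [Nat.cast_sub h]
          push_cast
          ring
        have hpos := ht (j - 1)
        rw [htj] at hprev hpos
        have htpos := ht0 j
        refine ⟨(1 + (t j - 3 / 10) ^ 2 / 2) / t j, ?_, ?_, ?_⟩
        · rw [le_div_iff₀ htpos]
          nlinarith [sq_nonneg (t j - 7 / 5)]
        · rw [le_div_iff₀ htpos]
          have : (3 / 20 * j + 3 / 20 : ℝ) = t j / 2 - 3 / 10 := by simp only [t]; ring
          rw [this]
          nlinarith
        · have h1 : q * ((1 + (t j - 3 / 10) ^ 2 / 2) / t j) * (q * t j) =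
              q ^ 2 + (q * (t j - 3 / 10)) ^ 2 / 2 := by field_simp
          rw [h1]
          have h2 : 0 ≤ q * (t j - 3 / 10) := by positivity
          have h3 : (q * (t j - 3 / 10)) ^ 2 ≤ ‖u‖ ^ 2 := by gcongr
          linarith
    obtain ⟨f, hf, hfj, hfX⟩ := key
    refine mem_iUnion.2 ⟨j, u, ⟨hu, by simpa using hj⟩, ?_⟩
    have hs : 0 < q * t j := mul_pos hq (ht0 j)
    have h1 := peeling_exponent_le j hK6 hKp hf hfj
    have h2 : 3 / 2 * (l * q) * f ≤ l * X u w / (2 * (q * t j)) := by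
      rw [le_div_iff₀ (by positivity)]
      nlinarith [mul_le_mul_of_nonneg_left hfX hl]
    simp only [τ]
    nlinarith
  have hτ : ∀ j, ENNReal.ofReal (Real.exp (-τ j)) =
      ENNReal.ofReal (Real.exp (-x)) * ENNReal.ofReal ((1 / 2) ^ (j + 1)) := fun j => by
    rw [← ENNReal.ofReal_mul (Real.exp_pos _).le]
    congr 1
    have h1 : Real.exp (-((j + 1 : ℕ) * Real.log 2)) = (1 / 2) ^ (j + 1) := by
      rw [Real.exp_neg, Real.exp_nat_mul, Real.exp_log two_pos, one_div, inv_pow]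
    rw [← h1, ← Real.exp_add]
    simp only [τ]
    push_cast
    ring_nf
  have hsum : ∑' j : ℕ, ENNReal.ofReal ((1 / 2) ^ (j + 1)) = 1 := by
    have h1 : HasSum (fun j : ℕ => (1 / 2 : ℝ) ^ (j + 1)) 1 := by
      have := hasSum_geometric_two.mul_left (1 / 2 : ℝ)
      simp only [pow_succ']
      simpa using this
    rw [← ENNReal.ofReal_tsum_of_nonneg (fun j => by positivity) h1.summable, h1.tsum_eq,
      ENNReal.ofReal_one]
  calc _ ≤ μ (⋃ j, E j) := measure_mono hsub
    _ ≤ ∑' j, μ (E j) := measure_iUnion_le _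
    _ ≤ ∑' j, ENNReal.ofReal (Real.exp (-x)) * ENNReal.ofReal ((1 / 2) ^ (j + 1)) :=
        ENNReal.tsum_le_tsum fun j => (hE j).trans_eq (hτ j)
    _ = _ := by rw [ENNReal.tsum_mul_left, hsum, mul_one]

/-- The penalized deviation bound at the level `zQuant`. -/
lemma measure_penalized_sup_ge_zQuant_le {μ : Measure Ω} {p : ℕ} (hp : 1 ≤ p)
    {X : ParamSpace p → Ω → ℝ} {B : Set (ParamSpace p)} (h0 : 0 ∈ B)
    (hX0 : ∀ w, X 0 w = 0) (hmeas : ∀ u ∈ B, AEMeasurable (X u) μ)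
    (hcont : ∀ᵐ w ∂μ, ContinuousOn (fun u => X u w) B) {g₀ x : ℝ} (hg₀ : 3 ≤ g₀) (hx : 0 ≤ x)
    (hinc : ∀ u ∈ B, ∀ v ∈ B, ∀ κ : ℝ, 0 ≤ κ → κ * dist u v ≤ g₀ →
      ∫⁻ w, ENNReal.ofReal (Real.exp (κ * (X u w - X v w))) ∂μ ≤
        ENNReal.ofReal (Real.exp ((κ * dist u v) ^ 2 / 2))) :
    ∃ z < zQuant g₀ x (entropyConst p), 0 ≤ z ∧
      μ {w | ∃ u ∈ B, z + ‖u‖ ^ 2 / 2 ≤ X u w / 3} ≤ ENNReal.ofReal (Real.exp (-x)) := by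
  have hQ0 : 0 ≤ entropyConst p := by unfold entropyConst; positivity
  have hσ := Real.sqrt_nonneg (x + entropyConst p)
  have hsq : Real.sqrt (x + entropyConst p) ^ 2 = x + entropyConst p := Real.sq_sqrt (by linarith)
  set σ := Real.sqrt (x + entropyConst p) with hσdef
  unfold zQuant
  split_ifs with h
  · have hq : 0 < 99 / 100 * (1 + σ) := by positivity
    -- The factor `99 / 100` makes the level strictly smaller, while its square still exceeds `49 /
    -- 50`. Here `l = q`.
    refine ⟨(99 / 100 * (1 + σ)) ^ 2, by nlinarith, by positivity, ?_⟩
    refine measure_penalized_sup_ge_le hp h0 hX0 hmeas hcont hq.le le_rfl hq hx ?_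
      fun u hu v hv κ hκ hκl => hinc u hu v hv κ hκ (hκl.trans ?_)
    · nlinarith
    · linarith
  · have hg : 0 < g₀ := by linarith
    have hb : 0 ≤ 2 * g₀⁻¹ * (x + entropyConst p) := by positivity
    have hq : 0 < 2 * g₀⁻¹ * (x + entropyConst p) + g₀ := by linarith
    -- The summand `1` of `zQuant` supplies the strict gap. With `l = g₀`, `l * q = 2 σ² + g₀²`
    -- dominates because `(1 + σ)² ≤ 2 + 2 σ²`.
    refine ⟨(2 * g₀⁻¹ * (x + entropyConst p) + g₀) ^ 2, by linarith, by positivity, ?_⟩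
    refine measure_penalized_sup_ge_le hp h0 hX0 hmeas hcont hg.le (by linarith) hq hx ?_ hinc
    have h1 : g₀ * (2 * g₀⁻¹ * (x + entropyConst p) + g₀) = 2 * σ ^ 2 + g₀ ^ 2 := by
      rw [hsq]; field_simp
    rw [h1]
    nlinarith [sq_nonneg (σ - 1)]

/-! ### Normalising coordinates and the linear remainder. -/

lemma toEuclideanCLM_inv_apply_apply {p : ℕ} {V : Matrix (Fin p) (Fin p) ℝ} (hV : V.PosDef)
    (u : ParamSpace p) :
    Matrix.toEuclideanCLM (𝕜 := ℝ) V⁻¹ (Matrix.toEuclideanCLM (𝕜 := ℝ) V u) = u := by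
  rw [← mul_apply_eq_comp, ← map_mul,
    Matrix.nonsing_inv_mul _ ((Matrix.isUnit_iff_isUnit_det _).1 hV.isUnit), map_one]
  rfl

lemma toEuclideanCLM_apply_inv_apply {p : ℕ} {V : Matrix (Fin p) (Fin p) ℝ} (hV : V.PosDef)
    (u : ParamSpace p) :
    Matrix.toEuclideanCLM (𝕜 := ℝ) V (Matrix.toEuclideanCLM (𝕜 := ℝ) V⁻¹ u) = u := by
  rw [← mul_apply_eq_comp, ← map_mul,
    Matrix.mul_nonsing_inv _ ((Matrix.isUnit_iff_isUnit_det _).1 hV.isUnit), map_one]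
  rfl

lemma matNorm_pos {p : ℕ} {V : Matrix (Fin p) (Fin p) ℝ} (hV : V.PosDef) {γ : ParamSpace p}
    (hγ : γ ≠ 0) : 0 < matNorm V γ := by
  refine norm_pos_iff.2 fun h => hγ ?_
  rw [← toEuclideanCLM_inv_apply_apply hV γ, h, map_zero]

lemma self_mem_localSet {p : ℕ} {Θ : Set (ParamSpace p)} {V : Matrix (Fin p) (Fin p) ℝ}
    {θs : ParamSpace p} {r : ℝ} (hθs : θs ∈ Θ) (hr : 0 ≤ r) : θs ∈ localSet Θ V θs r :=
  ⟨hθs, by simpa [matNorm] using hr⟩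

lemma line_mem_of_convex {p : ℕ} {S : Set (ParamSpace p)} (hS : Convex ℝ S)
    {θ θ' : ParamSpace p} (hθ : θ ∈ S) (hθ' : θ' ∈ S) {t : ℝ} (ht : t ∈ Icc (0 : ℝ) 1) :
    θ' + t • (θ - θ') ∈ S := hS.add_smul_sub_mem hθ' hθ ht

/-- The supremum need not be attained, so a witness exists only at a strictly lower level `z`. -/
lemma exists_lt_of_le_inv_mul_iSup {E : Type*} {S : Set E} {h : E → ℝ} {ω z Z : ℝ} (hω : 0 < ω)
    (hz : z < Z) (hle : (Z : EReal) ≤ ((ω⁻¹ : ℝ) : EReal) * ⨆ θ ∈ S, (h θ : EReal)) :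
    ∃ θ ∈ S, z * ω < h θ := by
  by_contra! hcon
  have h1 : (⨆ θ ∈ S, (h θ : EReal)) ≤ ((z * ω : ℝ) : EReal) :=
    iSup₂_le fun θ hθ => EReal.coe_le_coe_iff.2 (hcon θ hθ)
  have h2 : ((ω⁻¹ : ℝ) : EReal) * ⨆ θ ∈ S, (h θ : EReal) ≤ ((ω⁻¹ * (z * ω) : ℝ) : EReal) := by
    rw [EReal.coe_mul]
    exact mul_le_mul_of_nonneg_left h1 (EReal.coe_nonneg.2 (inv_nonneg.2 hω.le))
  have h3 := EReal.coe_le_coe_iff.1 (hle.trans h2)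
  have h4 : ω⁻¹ * (z * ω) = z := by field_simp
  linarith

lemma zQuant_pos {g₀ x Q : ℝ} : 0 < zQuant g₀ x Q := by
  unfold zQuant
  split_ifs <;> positivity

/-- Along a segment in `Θ`, the linear remainder has the derivative predicted by the gradient. -/
lemma hasDerivWithinAt_linRemainder {μ : Measure Ω} {p : ℕ} {Θ : Set (ParamSpace p)}
    {L : ParamSpace p → Ω → ℝ} {θs θ' γ : ParamSpace p} {w : Ω}
    (hw : DifferentiableOn ℝ (fun θ => stochComp μ L θ w) Θ)
    (hseg : ∀ t ∈ Icc (0 : ℝ) 1, θ' + t • γ ∈ Θ) {t : ℝ} (ht : t ∈ Icc (0 : ℝ) 1) :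
    HasDerivWithinAt (fun s => stochComp μ L (θ' + s • γ) w)
      (inner ℝ γ (gradStoch μ L Θ (θ' + t • γ) w)) (Icc 0 1) t ∧
    HasDerivWithinAt (fun s => linRemainder μ L Θ θs (θ' + s • γ) w)
      (inner ℝ γ (gradStoch μ L Θ (θ' + t • γ) w - gradStoch μ L Θ θs w)) (Icc 0 1) t := by
  have hline : HasDerivWithinAt (fun s : ℝ => θ' + s • γ) γ (Icc 0 1) t := by
    simpa using (((hasDerivAt_id t).smul_const γ).const_add θ').hasDerivWithinAt
  have h1 := (hw _ (hseg t ht)).hasFDerivWithinAt.comp_hasDerivWithinAt t hline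
    (fun s hs => hseg s hs)
  have h2 : fderivWithin ℝ (fun θ => stochComp μ L θ w) Θ (θ' + t • γ) γ =
      inner ℝ γ (gradStoch μ L Θ (θ' + t • γ) w) := by
    rw [real_inner_comm]
    exact (InnerProductSpace.toDual_symm_apply).symm
  rw [h2] at h1
  refine ⟨h1, ?_⟩
  have h3 : HasDerivWithinAt (fun s : ℝ => inner ℝ (θ' + s • γ - θs) (gradStoch μ L Θ θs w))
      (inner ℝ γ (gradStoch μ L Θ θs w)) (Icc 0 1) t := by
    simpa using (hline.sub_const θs).inner ℝ
      (hasDerivWithinAt_const t (Icc (0 : ℝ) 1) (gradStoch μ L Θ θs w))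
  rw [inner_sub_right]
  exact (h1.sub_const _).sub h3

/-- Measurability of the gradient is not assumed: its component along `θ - θs` is an almost sure
limit of difference quotients along the segment. -/
lemma aemeasurable_linRemainder {μ : Measure Ω} {p : ℕ} {Θ : Set (ParamSpace p)}
    {L : ParamSpace p → Ω → ℝ} {θs θ : ParamSpace p} {S : Set (ParamSpace p)} (hSΘ : S ⊆ Θ)
    (hL : ∀ θ ∈ Θ, Integrable (L θ) μ)
    (hdiff : ∀ᵐ w ∂μ, DifferentiableOn ℝ (fun θ => stochComp μ L θ w) Θ)
    (hS : Convex ℝ S) (hθs : θs ∈ S) (hθ : θ ∈ S) :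
    AEMeasurable (fun w => linRemainder μ L Θ θs θ w) μ := by
  have hm : ∀ θ ∈ Θ, AEMeasurable (fun w => stochComp μ L θ w) μ := fun θ hθ =>
    (hL θ hθ).aemeasurable.sub_const _
  have hseg : ∀ t ∈ Icc (0 : ℝ) 1, θs + t • (θ - θs) ∈ Θ := fun t ht =>
    hSΘ (line_mem_of_convex hS hθ hθs ht)
  have hin : ∀ n : ℕ, 1 / ((n : ℝ) + 1) ∈ Icc (0 : ℝ) 1 := fun n =>
    ⟨by positivity, div_le_one_of_le₀ (by linarith [n.cast_nonneg (α := ℝ)]) (by positivity)⟩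
  have hgrad : AEMeasurable (fun w => inner ℝ (θ - θs) (gradStoch μ L Θ θs w)) μ := by
    refine aemeasurable_of_tendsto_metrizable_ae (u := atTop)
      (f := fun (n : ℕ) w => ((1 / ((n : ℝ) + 1))⁻¹ *
        (stochComp μ L (θs + (1 / ((n : ℝ) + 1)) • (θ - θs)) w - stochComp μ L θs w)))
      (fun n => ((hm _ (hseg _ (hin n))).sub (hm _ (hSΘ hθs))).const_mul _) ?_
    filter_upwards [hdiff] with w hw
    have h1 := (hasDerivWithinAt_linRemainder (θs := θs) hw hseg
      (left_mem_Icc.2 zero_le_one)).1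
    rw [hasDerivWithinAt_iff_tendsto_slope] at h1
    have h2 : Tendsto (fun n : ℕ => 1 / ((n : ℝ) + 1)) atTop (𝓝[Icc (0 : ℝ) 1 \ {0}] 0) := by
      refine tendsto_nhdsWithin_iff.2 ⟨tendsto_one_div_add_atTop_nhds_zero_nat,
        Eventually.of_forall fun n => ⟨hin n, ?_⟩⟩
      have : (0 : ℝ) < 1 / ((n : ℝ) + 1) := by positivity
      exact this.ne'
    have h3 := h1.comp h2
    simp only [zero_smul, add_zero] at h3
    refine h3.congr fun n => ?_
    simp [slope]
  exact ((hm _ (hSΘ hθ)).sub (hm _ (hSΘ hθs))).sub hgrad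

lemma ConditionED1.lintegral_exp_le {μ : Measure Ω} [IsProbabilityMeasure μ] {p : ℕ}
    {L : ParamSpace p → Ω → ℝ} {Θ : Set (ParamSpace p)} {V : Matrix (Fin p) (Fin p) ℝ}
    {θs : ParamSpace p} {ν g r₀ : ℝ} {ρ : ℝ → ℝ} (h : ConditionED1 μ L Θ V θs ν g r₀ ρ)
    {r : ℝ} (hr : 0 < r) (hrr₀ : r ≤ r₀) {θ : ParamSpace p} (hθ : θ ∈ localSet Θ V θs r)
    {γ : ParamSpace p} (hγ : γ ≠ 0) {t b : ℝ} (ht : |t| ≤ g) (hb : b = t / (ρ r * matNorm V γ)) :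
    ∫⁻ w, ENNReal.ofReal (Real.exp (b *
      inner ℝ γ (gradStoch μ L Θ θ w - gradStoch μ L Θ θs w))) ∂μ ≤
        ENNReal.ofReal (Real.exp (ν ^ 2 * t ^ 2 / 2)) := by
  obtain ⟨hint, hlog⟩ := (h r hr hrr₀).2.2 θ hθ γ hγ t ht
  rw [Real.log_le_iff_le_exp (integral_exp_pos hint)] at hlog
  refine le_trans (le_of_eq ?_) (ENNReal.ofReal_le_ofReal hlog)
  rw [ofReal_integral_eq_lintegral_ofReal hint (Eventually.of_forall fun _ => (Real.exp_pos _).le)]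
  refine lintegral_congr fun w => ?_
  rw [hb]
  congr 2
  ring

/-- Exponential moments of the increments of the linear remainder. -/
lemma lintegral_exp_linRemainder_sub_le {μ : Measure Ω} [IsProbabilityMeasure μ] {p : ℕ}
    {L : ParamSpace p → Ω → ℝ} {Θ : Set (ParamSpace p)} {V : Matrix (Fin p) (Fin p) ℝ}
    (hV : V.PosDef) {θs : ParamSpace p} (hθs : θs ∈ Θ)
    (hL : ∀ θ ∈ Θ, Integrable (L θ) μ)
    (hdiff : ∀ᵐ w ∂μ, DifferentiableOn ℝ (fun θ => stochComp μ L θ w) Θ)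
    {ν g r₀ : ℝ} {ρ : ℝ → ℝ} (hν : 1 ≤ ν) (hg : 3 ≤ g * ν)
    (h : ConditionED1 μ L Θ V θs ν g r₀ ρ)
    {r : ℝ} (hr : 0 < r) (hrr₀ : r ≤ r₀) (hconv : Convex ℝ (localSet Θ V θs r))
    {θ θ' : ParamSpace p} (hθ : θ ∈ localSet Θ V θs r) (hθ' : θ' ∈ localSet Θ V θs r)
    {κ : ℝ} (hκ : 0 ≤ κ) (hκg : κ * matNorm V (θ - θ') ≤ g * ν) :
    ∫⁻ w, ENNReal.ofReal (Real.exp (κ * (linRemainder μ L Θ θs θ w / (ν * ρ r) -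
      linRemainder μ L Θ θs θ' w / (ν * ρ r)))) ∂μ ≤
        ENNReal.ofReal (Real.exp ((κ * matNorm V (θ - θ')) ^ 2 / 2)) := by
  have hν0 : 0 < ν := by linarith
  have hg0 : 0 < g := pos_of_mul_pos_left (by linarith) hν0.le
  have hρ : 0 < ρ r := (h r hr hrr₀).1
  have hSΘ : localSet Θ V θs r ⊆ Θ := fun θ hθ => hθ.1
  by_cases hγ : θ - θ' = 0
  · rw [sub_eq_zero.1 hγ]
    simp [matNorm]
  have hd : 0 < matNorm V (θ - θ') := matNorm_pos hV hγ
  set d := matNorm V (θ - θ') with hd_def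
  have hmem : ∀ t ∈ Icc (0 : ℝ) 1, θ' + t • (θ - θ') ∈ localSet Θ V θs r := fun t ht =>
    line_mem_of_convex hconv hθ hθ' ht
  have key := lintegral_exp_increment_le (μ := μ)
    (F := fun t w => linRemainder μ L Θ θs (θ' + t • (θ - θ')) w)
    (D := fun t w => inner ℝ (θ - θ')
      (gradStoch μ L Θ (θ' + t • (θ - θ')) w - gradStoch μ L Θ θs w))
    (a := g / (ρ r * d)) (κ := κ / (ν * ρ r))
    (C₀ := ENNReal.ofReal (Real.exp (ν ^ 2 * g ^ 2 / 2)))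
    (C := ENNReal.ofReal (Real.exp ((κ * d) ^ 2 / 2)))
    (fun t ht => aemeasurable_linRemainder hSΘ hL hdiff hconv (self_mem_localSet hθs hr.le)
      (hmem t ht))
    (by
      filter_upwards [hdiff] with w hw t ht
      exact (hasDerivWithinAt_linRemainder hw (fun s hs => hSΘ (hmem s hs)) ht).2)
    (by positivity) ENNReal.ofReal_ne_top
    (fun t ht => h.lintegral_exp_le hr hrr₀ (hmem t ht) hγ (abs_of_pos hg0).le rfl)
    (fun t ht => by
      have := h.lintegral_exp_le hr hrr₀ (hmem t ht) hγ (t := -g) (b := -(g / (ρ r * d)))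
        (by rw [abs_neg, abs_of_pos hg0]) (by rw [neg_div])
      simpa using this)
    (fun t ht => by
      -- (ED₁) is used at order `κ * d / ν`: its range `|t| ≤ g` becomes `κ * d ≤ g * ν`, and `ν² t²
      -- / 2` becomes `(κ * d)² / 2`.
      have hle : |κ * d / ν| ≤ g := by
        rw [abs_of_nonneg (by positivity), div_le_iff₀ hν0]
        exact hκg
      refine (h.lintegral_exp_le hr hrr₀ (hmem t ht) hγ hle (b := κ / (ν * ρ r)) ?_).trans_eq ?_
      · rw [← hd_def]
        field_simp
      · congr 2
        field_simp)
  refine le_trans (le_of_eq (lintegral_congr fun w => ?_)) key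
  congr 2
  simp only [one_smul, zero_smul, add_zero, add_sub_cancel]
  ring

/-- Deviation bound for the bracketing error with sign `e`. -/
lemma measure_bracketing_error_ge_le {μ : Measure Ω} [IsProbabilityMeasure μ] {p : ℕ}
    {L : ParamSpace p → Ω → ℝ} {Θ : Set (ParamSpace p)} {V : Matrix (Fin p) (Fin p) ℝ}
    (hV : V.PosDef) {θs : ParamSpace p} (hθs : θs ∈ Θ)
    (hL : ∀ θ ∈ Θ, Integrable (L θ) μ)
    (hdiff : ∀ᵐ w ∂μ, DifferentiableOn ℝ (fun θ => stochComp μ L θ w) Θ)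
    {ν g r₀ : ℝ} {ρ : ℝ → ℝ} (hν : 1 ≤ ν) (hg : 3 ≤ g * ν)
    (h : ConditionED1 μ L Θ V θs ν g r₀ ρ)
    {r : ℝ} (hr : 0 < r) (hrr₀ : r ≤ r₀) (hconv : Convex ℝ (localSet Θ V θs r))
    {ω : ℝ} (hω : 3 * ν * ρ r ≤ ω) {x : ℝ} (hx : 0 ≤ x) {e : ℝ} (he : e = 1 ∨ e = -1) :
    μ {w | ((zQuant (g * ν) x (entropyConst p) : ℝ) : EReal) ≤ ((ω⁻¹ : ℝ) : EReal) *
      ⨆ θ ∈ localSet Θ V θs r,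
        ((e * linRemainder μ L Θ θs θ w - ω / 2 * matNorm V (θ - θs) ^ 2 : ℝ) : EReal)} ≤
      ENNReal.ofReal (Real.exp (-x)) := by
  have hν0 : 0 < ν := by linarith
  have hρ : 0 < ρ r := (h r hr hrr₀).1
  have hc : 0 < ν * ρ r := mul_pos hν0 hρ
  have hω0 : 0 < ω := by nlinarith
  have hSΘ : localSet Θ V θs r ⊆ Θ := fun θ hθ => hθ.1
  have hR0 : ∀ w, linRemainder μ L Θ θs θs w = 0 := fun w => by simp [linRemainder]
  -- In dimension zero the remainder vanishes and the level is positive, so the event is empty.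
  rcases Nat.eq_zero_or_pos p with rfl | hp
  · refine le_trans (le_of_eq ?_) zero_le
    convert measure_empty (μ := μ)
    refine eq_empty_of_forall_notMem fun w hw => ?_
    obtain ⟨θ, -, hθ⟩ := exists_lt_of_le_inv_mul_iSup hω0 zQuant_pos hw
    rw [Subsingleton.elim θ θs, hR0] at hθ
    simp [matNorm] at hθ
  let T := Matrix.toEuclideanCLM (n := Fin p) (𝕜 := ℝ) V
  let T' := Matrix.toEuclideanCLM (n := Fin p) (𝕜 := ℝ) V⁻¹
  let S := localSet Θ V θs r
  let B : Set (ParamSpace p) := {u | θs + T' u ∈ S}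
  let X : ParamSpace p → Ω → ℝ := fun u w => e * (linRemainder μ L Θ θs (θs + T' u) w / (ν * ρ r))
  have hdist : ∀ u v, matNorm V ((θs + T' u) - (θs + T' v)) = dist u v := fun u v => by
    rw [add_sub_add_left_eq_sub, ← map_sub, dist_eq_norm, matNorm,
      toEuclideanCLM_apply_inv_apply hV]
  obtain ⟨z, hz, hz0, hbound⟩ := measure_penalized_sup_ge_zQuant_le (μ := μ) (X := X) (B := B)
    (g₀ := g * ν) (x := x) hp
    (by simpa [B, S] using self_mem_localSet (V := V) hθs hr.le) (fun w => by simp [X, hR0])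
    (fun u hu => ((aemeasurable_linRemainder hSΘ hL hdiff hconv
      (self_mem_localSet hθs hr.le) hu).div_const _).const_mul _)
    (by
      filter_upwards [hdiff] with w hw
      have hφ : Continuous fun u => θs + T' u := by fun_prop
      have h1 : ContinuousOn (fun u => stochComp μ L (θs + T' u) w) B :=
        hw.continuousOn.comp hφ.continuousOn fun u hu => hSΘ hu
      have h2 : Continuous fun u => inner ℝ (θs + T' u - θs) (gradStoch μ L Θ θs w) := by fun_prop
      exact (((h1.sub continuousOn_const).sub h2.continuousOn).div_const _).const_smul e)
    hg hx
    (fun u hu v hv κ hκ hκg => by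
      rcases he with rfl | rfl
      · rw [← hdist] at hκg ⊢
        simp only [X, one_mul]
        exact lintegral_exp_linRemainder_sub_le hV hθs hL hdiff hν hg h hr hrr₀ hconv hu hv hκ hκg
      -- The sign change exchanges the endpoints of the increment.
      · rw [dist_comm, ← hdist] at hκg ⊢
        have := lintegral_exp_linRemainder_sub_le hV hθs hL hdiff hν hg h hr hrr₀ hconv hv hu hκ hκg
        simp only [X, neg_one_mul, neg_sub_neg]
        exact this)
  refine le_trans (measure_mono fun w hw => ?_) hbound
  obtain ⟨θ, hθ, hlt⟩ := exists_lt_of_le_inv_mul_iSup hω0 hz hw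
  have hback : θs + T' (T (θ - θs)) = θ := by
    simp only [T, T']
    rw [toEuclideanCLM_inv_apply_apply hV, add_sub_cancel]
  refine ⟨T (θ - θs), by simpa only [B, mem_ofPred_eq, hback] using hθ, ?_⟩
  simp only [X]
  rw [hback]
  change z + matNorm V (θ - θs) ^ 2 / 2 ≤ _
  rw [mul_div_assoc', div_div, le_div_iff₀ (by positivity)]
  have hnn : 0 ≤ z + matNorm V (θ - θs) ^ 2 / 2 := by positivity
  nlinarith [mul_le_mul_of_nonneg_left hω hnn]

end

theorem mainTheorem2 {Ω : Type*} [MeasurableSpace Ω] (μ : Measure Ω) [IsProbabilityMeasure μ]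
    {p : ℕ} (Θ : Set (ParamSpace p)) (L : ParamSpace p → Ω → ℝ) (θs : ParamSpace p)
    (hθs : θs ∈ Θ)
    (hL : ∀ θ ∈ Θ, Integrable (L θ) μ)
    (hdiff : ∀ᵐ w ∂μ, DifferentiableOn ℝ (fun θ => stochComp μ L θ w) Θ)
    (V : Matrix (Fin p) (Fin p) ℝ) (hV : V.PosDef)
    (ν g r₀ : ℝ) (ρ : ℝ → ℝ) (hν : 1 ≤ ν) (hg : 3 ≤ g * ν)
    (hED1 : ConditionED1 μ L Θ V θs ν g r₀ ρ)
    (r : ℝ) (hr : 0 < r) (hrr₀ : r ≤ r₀)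
    (hconv : Convex ℝ (localSet Θ V θs r))
    (ω : ℝ) (hω : 3 * ν * ρ r ≤ ω)
    (x : ℝ) (hx : 0 ≤ x) :
    μ {w | ((zQuant (g * ν) x (entropyConst p) : ℝ) : EReal)
        ≤ ((ω⁻¹ : ℝ) : EReal) * upperError μ L Θ V θs ω r w} ≤ ENNReal.ofReal (Real.exp (-x)) ∧
    μ {w | ((zQuant (g * ν) x (entropyConst p) : ℝ) : EReal)
        ≤ ((ω⁻¹ : ℝ) : EReal) * lowerError μ L Θ V θs ω r w} ≤ ENNReal.ofReal (Real.exp (-x)) := by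
  constructor
  · simpa only [upperError, one_mul] using measure_bracketing_error_ge_le hV hθs hL hdiff hν hg
      hED1 hr hrr₀ hconv hω hx (Or.inl rfl)
  · simpa only [lowerError, neg_one_mul] using measure_bracketing_error_ge_le hV hθs hL hdiff hν hg
      hED1 hr hrr₀ hconv hω hx (Or.inr rfl)
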